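/- Let $n\ge 1$ and let $G$ be a 4-regular multigraph on the vertex set $V=\{x_1,\dots,x_{3n}\}$ (put $x_{3n+1}=x_1$) whose multiset of edges is the union, counted with multiplicity, of the edges of the Hamiltonian cycle $x_1-x_2-\dots-x_{3n}-x_1$ and of the edges of $n$ triangles $a_i-b_i-c_i-a_i$, $i=1,\dots,n$ (for each $i$, the vertices $a_i,b_i,c_i\in V$ are distinct). Regard the vertices as independent commuting variables and consider the Laurent polynomial with integer coefficients $$\Phi(x_1,\dots,x_{3n})=\prod_{i=1}^{3n}\Bigl(1-\frac{x_{i+1}}{x_i}\Bigr)\prod_{i=1}^{n}\Bigl(1-\frac{a_i}{b_i}\Bigr)\Bigl(1-\frac{b_i}{c_i}\Bigr)\Bigl(1-\frac{c_i}{a_i}\Bigr).$$ Then the constant term of $\Phi$ is congruent to $2$ modulo $4$. -/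

import Mathlib

noncomputable section

/-- A finite multigraph on the vertex set `V`, given by its multiset of edges (unordered pairs);
parallel edges are allowed and are counted with multiplicity. -/
abbrev MultiEdgeGraph (V : Type*) : Type _ := Multiset (Sym2 V)

namespace MultiEdgeGraph

variable {V : Type*}

/-- The degree of a vertex: the number of edge ends at it (a loop has two ends). -/
def degree [DecidableEq V] (G : MultiEdgeGraph V) (v : V) : ℕ :=
  (G.map fun e => (e.toMultiset : Multiset V).count v).sum

/-- Every vertex has degree `d`. -/
def IsRegular [DecidableEq V] (G : MultiEdgeGraph V) (d : ℕ) : Prop :=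
  ∀ v, G.degree v = d

/-- The closed cycle `x 0 - x 1 - ⋯ - x (m - 1) - x 0`. -/
def cycle {m : ℕ} (x : Fin m → V) : MultiEdgeGraph V :=
  ∑ i : Fin m, {s(x i, x (finRotate m i))}

/-- The triangle `a - b - c - a`. -/
def triangle (a b c : V) : MultiEdgeGraph V :=
  {s(a, b), s(b, c), s(c, a)}

end MultiEdgeGraph

/-- Laurent polynomials with integer coefficients in commuting variables indexed by `V`:
the group ring of the group of exponent vectors. -/
abbrev LaurentRing (V : Type*) : Type _ := AddMonoidAlgebra ℤ (V →₀ ℤ)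

namespace LaurentRing

variable {V : Type*}

/-- The variable attached to `v`. -/
def X (v : V) : LaurentRing V := AddMonoidAlgebra.single (Finsupp.single v 1) 1

/-- The Laurent monomial `u / v`. -/
def ratio (u v : V) : LaurentRing V :=
  AddMonoidAlgebra.single (Finsupp.single u 1 - Finsupp.single v 1) 1

theorem ratio_mul_X (u v : V) : ratio u v * X v = X u := by
  simp [ratio, X, AddMonoidAlgebra.single_mul_single]

/-- The constant term. -/
def constantTerm (f : LaurentRing V) : ℤ := f.coeff 0

/-- The Laurent polynomial
`∏ (1 - x_{i+1} / x_i) * ∏ (1 - a_i / b_i) (1 - b_i / c_i) (1 - c_i / a_i)`,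
where the index of `x` is taken cyclically. -/
def cycleTrianglePoly {m n : ℕ} (x : Fin m → V) (a b c : Fin n → V) : LaurentRing V :=
  (∏ i : Fin m, (1 - ratio (x (finRotate m i)) (x i))) *
    ∏ i : Fin n, ((1 - ratio (a i) (b i)) * (1 - ratio (b i) (c i)) * (1 - ratio (c i) (a i)))

end LaurentRing

end

/-! Expand the product. Since the constants in a triangle factor cancel, each triangle contributes
one directed side, a chord of the Hamiltonian circle; by 4-regularity the triangles partition the
vertices. The constant term is thus a signed count of balanced selections of cycle edges and
directed chords. Complementing every choice preserves balance and, as `3n + n` is even, the sign, so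
the constant term is `2K`, and it remains to show that `K` is odd (`sum_balanced_modEq_two`).

Modulo 2, fix the chords. Balance forces the cycle edges to follow the prefix parity of chord ends,
and the chords can be directed, uniquely, iff each crosses an even number of others. With crossing
parities `w`, set to 1 on the diagonal, `K` is the sum over chord choices of `∏ i, ∑ j, w i j`.
Crossing is symmetric, and the three sides of a triangle cross any chord of another triangle an even
number of times in all, so `sum_prod_sum_eq_one` applies. -/

/-- For a symmetric family of weights in `ZMod 2` with unit diagonal whose sums over either argument
vanish off the diagonal: after expanding the product only permutations contribute, and these cancel
in pairs of mutual inverses, except for the identity. -/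
theorem sum_prod_sum_eq_one {ι α : Type*} [Fintype ι] [DecidableEq ι] [Fintype α] [DecidableEq α]
    (hα : Odd (Fintype.card α)) (w : ι → ι → α → α → ZMod 2)
    (hdiag : ∀ i p q, w i i p q = 1) (hsymm : ∀ i j p q, w i j p q = w j i q p)
    (hsum : ∀ i j, i ≠ j → ∀ q, ∑ p, w i j p q = 0) :
    ∑ p : ι → α, ∏ i, ∑ j, w i j (p i) (p j) = 1 := by
  -- Resampling one coordinate counts each `p` exactly `card α` times, an odd number.
  have key : ∀ (i : ι) (g : (ι → α) → ZMod 2),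
      (∀ p, ∑ r, g (Function.update p i r) = 0) → ∑ p, g p = 0 := by
    intro i g hg
    have h1 : ∑ p : ι → α, ∑ r, g (Function.update p i r) = ∑ r : α, ∑ p, g p := by
      rw [← Fintype.sum_prod_type', ← Fintype.sum_prod_type']
      let e : (ι → α) × α ≃ α × (ι → α) :=
        { toFun := fun x => (x.1 i, Function.update x.1 i x.2)
          invFun := fun x => (Function.update x.2 i x.1, x.2 i)
          left_inv := fun x => by simp
          right_inv := fun x => by simp }
      exact Fintype.sum_equiv e _ _ (fun x => rfl)
    simp only [hg, Finset.sum_const_zero, Finset.sum_const, Finset.card_univ, nsmul_eq_mul] at h1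
    have h2 : ((Fintype.card α : ℕ) : ZMod 2) = 1 := by
      rwa [ZMod.natCast_eq_one_iff_odd]
    rw [h2, one_mul] at h1
    exact h1.symm
  set t : (ι → ι) → ZMod 2 := fun f => ∑ p : ι → α, ∏ i, w i (f i) (p i) (p (f i)) with ht
  have hexp : ∑ p : ι → α, ∏ i, ∑ j, w i j (p i) (p j) = ∑ f : ι → ι, t f := by
    rw [ht, Finset.sum_comm]
    refine Finset.sum_congr rfl fun p _ => ?_
    rw [Finset.prod_univ_sum, Fintype.piFinset_univ]
  have hnon : ∀ f : ι → ι, ¬ Function.Bijective f → t f = 0 := by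
    intro f hf
    rw [← Finite.surjective_iff_bijective] at hf
    simp only [Function.Surjective, not_forall, not_exists] at hf
    obtain ⟨i, hi⟩ := hf
    -- As `i` is not a value of `f`, the coordinate `p i` enters only the factor at `i`.
    refine key i _ fun p => ?_
    have h2 : ∀ r, ∏ j, w j (f j) (Function.update p i r j) (Function.update p i r (f j))
        = w i (f i) r (p (f i)) * ∏ j ∈ Finset.univ.erase i, w j (f j) (p j) (p (f j)) := by
      intro r
      rw [← Finset.mul_prod_erase _ _ (Finset.mem_univ i)]
      congr 1
      · simp [Function.update_of_ne (hi i)]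
      · refine Finset.prod_congr rfl fun j hj => ?_
        rw [Function.update_of_ne (Finset.ne_of_mem_erase hj), Function.update_of_ne (hi j)]
    simp only [h2]
    rw [← Finset.sum_mul, hsum i (f i) (fun h => hi i h.symm), zero_mul]
  have hperm : ∑ f : ι → ι, t f = ∑ σ : Equiv.Perm ι, t σ := by
    symm
    apply Finset.sum_of_injOn (fun σ : Equiv.Perm ι => (σ : ι → ι))
    · exact fun σ _ τ _ h => DFunLike.coe_injective h
    · intro _ _; simp
    · intro f _ hf
      refine hnon f fun hb => hf ⟨Equiv.ofBijective f hb, by simp, rfl⟩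
    · intro _ _; rfl
  have hinv : ∀ σ : Equiv.Perm ι, t ⇑σ⁻¹ = t σ := by
    intro σ
    refine Finset.sum_congr rfl fun p _ => ?_
    rw [← Equiv.prod_comp σ]
    refine Finset.prod_congr rfl fun i _ => ?_
    rw [show σ⁻¹ (σ i) = i from σ.symm_apply_apply i, hsymm]
  have hone : t ⇑(1 : Equiv.Perm ι) = 1 := by
    simp only [ht, Equiv.Perm.coe_one, id, hdiag, Finset.prod_const_one, Finset.sum_const,
      Finset.card_univ, nsmul_eq_mul, mul_one, Fintype.card_fun]
    rw [ZMod.natCast_eq_one_iff_odd]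
    exact hα.pow
  have htwo : ∀ σ : Equiv.Perm ι, σ⁻¹ = σ → σ ≠ 1 → t σ = 0 := by
    intro σ hσ hne
    obtain ⟨i, hi⟩ : ∃ i, σ i ≠ i := by
      by_contra! h
      exact hne (Equiv.ext h)
    have hii : σ (σ i) = i := by
      have h := σ.symm_apply_apply i
      rwa [show σ.symm = σ from hσ] at h
    refine key i _ fun p => ?_
    have h2 : ∀ r, ∏ j, w j (σ j) (Function.update p i r j) (Function.update p i r (σ j))
        = w i (σ i) r (p (σ i)) *
          ∏ j ∈ (Finset.univ.erase i).erase (σ i), w j (σ j) (p j) (p (σ j)) := by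
      intro r
      rw [← Finset.mul_prod_erase _ _ (Finset.mem_univ i),
        ← Finset.mul_prod_erase _ _ (Finset.mem_erase.2 ⟨hi, Finset.mem_univ _⟩), ← mul_assoc]
      congr 1
      -- The factors at `i` and `σ i` coincide, and `z * z = z` in `ZMod 2`.
      · rw [hii, hsymm (σ i) i, Function.update_self, Function.update_of_ne hi]
        generalize w i (σ i) r (p (σ i)) = z
        revert z; decide
      · refine Finset.prod_congr rfl fun j hj => ?_
        simp only [Finset.mem_erase] at hj
        rw [Function.update_of_ne hj.2.1, Function.update_of_ne]
        intro h
        exact hj.1 (σ.injective (h.trans hii.symm))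
    simp only [h2]
    rw [← Finset.sum_mul, hsum i (σ i) hi.symm, zero_mul]
  rw [hexp, hperm, ← Finset.add_sum_erase _ _ (Finset.mem_univ 1), hone]
  suffices h : ∑ σ ∈ Finset.univ.erase (1 : Equiv.Perm ι), t σ = 0 by rw [h, add_zero]
  refine Finset.sum_involution (fun σ _ => σ⁻¹) ?_ ?_ ?_ ?_
  · intro σ _
    rw [hinv]
    exact CharTwo.add_self_eq_zero _
  · intro σ hσ h0 h
    exact h0 (htwo σ h (Finset.ne_of_mem_erase hσ))
  · intro σ hσ
    simpa using hσ
  · intro σ _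
    exact inv_inv σ

/-! ### Initial segments of the cycle modulo 2 -/

/-- The indicator of `a ≤ k`. -/
def leInd {m : ℕ} (a k : Fin m) : ZMod 2 := if a ≤ k then 1 else 0

theorem leInd_self {m : ℕ} (a : Fin m) : leInd a a = 1 := by simp [leInd]

theorem leInd_swap {m : ℕ} {a b : Fin m} (h : a ≠ b) : leInd a b = leInd b a + 1 := by
  unfold leInd
  rcases lt_or_gt_of_ne h with h | h
  · simp [h.le, h.not_ge]
  · simp [h.le, h.not_ge]; decide

theorem leInd_last {M : ℕ} (a : Fin (M + 1)) : leInd a (Fin.last M) = 1 := by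
  simp [leInd, Fin.le_last]

/-- The last term corrects the wrap-around: the cyclic predecessor of `0` is the last position,
where the indicator is 1. -/
theorem leInd_eq_pred {M : ℕ} (a k : Fin (M + 1)) :
    leInd a k = leInd a ((finRotate (M + 1)).symm k) + (if a = k then 1 else 0) +
      (if k = 0 then 1 else 0) := by
  obtain ⟨k, rfl⟩ := (finRotate (M + 1)).surjective k
  rw [Equiv.symm_apply_apply]
  by_cases hk : k = Fin.last M
  · subst hk
    rw [finRotate_last, leInd_last]
    by_cases ha : a = 0
    · subst ha; simp [leInd]; decide
    · simp [leInd, ha]; decide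
  · have h0 : finRotate (M + 1) k ≠ 0 := by
      intro h
      have h1 := coe_finRotate_of_ne_last hk
      rw [h] at h1
      simp at h1
    have h1 := coe_finRotate_of_ne_last hk
    simp only [leInd, h0, if_false, add_zero, Fin.le_def, Fin.ext_iff, h1]
    rcases lt_trichotomy (a : ℕ) (k + 1) with h | h | h
    · have h2 : (a : ℕ) ≤ k := by omega
      simp [h.le, h2, h.ne]
    · simp [h]
    · have h2 : ¬ (a : ℕ) ≤ k := by omega
      simp [h.not_ge, h2, h.ne']

/-- A function on a cycle is determined by its increments and one value. -/
theorem eq_of_cyclic_increments {M : ℕ} {y z : Fin (M + 1) → ZMod 2} (d : Fin (M + 1) → ZMod 2)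
    (hy : ∀ k, y k = y ((finRotate (M + 1)).symm k) + d k)
    (hz : ∀ k, z k = z ((finRotate (M + 1)).symm k) + d k)
    (hlast : y (Fin.last M) = z (Fin.last M)) : y = z := by
  have key : ∀ t : ℕ, ∀ h : t < M + 1, y ⟨t, h⟩ = z ⟨t, h⟩ := by
    intro t
    induction t with
    | zero =>
      intro h
      have h0 : (⟨0, h⟩ : Fin (M + 1)) = finRotate (M + 1) (Fin.last M) := by
        rw [finRotate_last]; rfl
      rw [hy, hz, h0, Equiv.symm_apply_apply, hlast]
    | succ t ih =>
      intro h
      have h0 : (⟨t + 1, h⟩ : Fin (M + 1)) = finRotate (M + 1) ⟨t, by omega⟩ := by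
        rw [finRotate_of_lt (by omega)]
      rw [hy, hz, h0, Equiv.symm_apply_apply, ih]
  exact funext fun k => key k k.2

/-! ### Balanced selections and crossing chords -/

section Circle

variable {n M : ℕ} (pos : Fin n × Fin 3 ≃ Fin (M + 1))

/-- `y` selects edges of the cycle; in the triangle `i` the state `(p i, s i)` omits the corner
`p i` and directs the remaining pair. The selection is balanced at each vertex. -/
def BalancedSelection (y : Fin (M + 1) → ZMod 2) (p : Fin n → Fin 3) (s : Fin n → ZMod 2) : Prop :=
  (∀ v, y (pos v) = y ((finRotate (M + 1)).symm (pos v)) + if v.2 = p v.1 then 0 else 1) ∧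
    ∀ i, y (pos (i, p i + 1)) = s i ∧ y (pos (i, p i + 2)) = s i + 1

instance (y : Fin (M + 1) → ZMod 2) (p : Fin n → Fin 3) (s : Fin n → ZMod 2) :
    Decidable (BalancedSelection pos y p s) := by
  unfold BalancedSelection; infer_instance

theorem balanced_add_one (y : Fin (M + 1) → ZMod 2) (p : Fin n → Fin 3) (s : Fin n → ZMod 2) :
    BalancedSelection pos (y + 1) p (s + 1) ↔ BalancedSelection pos y p s := by
  simp only [BalancedSelection, Pi.add_apply, Pi.one_apply, add_left_inj, add_right_comm _ (1 : ZMod 2)]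

/-- The parity of the number of chord ends in the initial segment up to `k`. -/
def prefixParity (p : Fin n → Fin 3) (k : Fin (M + 1)) : ZMod 2 :=
  ∑ j, (leInd (pos (j, p j + 1)) k + leInd (pos (j, p j + 2)) k)

theorem prefixParity_last (p : Fin n → Fin 3) : prefixParity pos p (Fin.last M) = 0 := by
  simp only [prefixParity, leInd_last, CharTwo.add_self_eq_zero, Finset.sum_const_zero]

theorem prefixParity_eq_pred (p : Fin n → Fin 3) (v : Fin n × Fin 3) :
    prefixParity pos p (pos v) = prefixParity pos p ((finRotate (M + 1)).symm (pos v)) +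
      if v.2 = p v.1 then 0 else 1 := by
  have h : ∀ j, leInd (pos (j, p j + 1)) (pos v) + leInd (pos (j, p j + 2)) (pos v) =
      (leInd (pos (j, p j + 1)) ((finRotate (M + 1)).symm (pos v)) +
        leInd (pos (j, p j + 2)) ((finRotate (M + 1)).symm (pos v))) +
      if j = v.1 then (if v.2 = p v.1 then 0 else 1) else 0 := by
    intro j
    obtain ⟨i, r⟩ := v
    rw [leInd_eq_pred (pos (j, p j + 1)), leInd_eq_pred (pos (j, p j + 2))]
    simp only [EmbeddingLike.apply_eq_iff_eq, Prod.mk.injEq]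
    by_cases hj : j = i
    · subst hj
      simp only [true_and, if_true]
      have h : ∀ (A B C : ZMod 2) (q r : Fin 3),
          A + (if q + 1 = r then 1 else 0) + C + (B + (if q + 2 = r then 1 else 0) + C) =
            A + B + if r = q then 0 else 1 := by decide
      convert h _ _ _ (p j) r
    · simp only [hj, false_and, if_false]
      generalize leInd _ _ = A
      generalize leInd _ _ = B
      generalize (if pos (i, r) = 0 then (1 : ZMod 2) else 0) = C
      revert A B C
      decide
  simp only [prefixParity, h, Finset.sum_add_distrib, Finset.sum_ite_eq', Finset.mem_univ, if_true]

/-- Balance prescribes the increments of `y`, and they are those of the prefix parity, which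
vanishes at the last position because chord ends come in pairs. -/
theorem balanced_and_last_iff (y : Fin (M + 1) → ZMod 2) (p : Fin n → Fin 3) (s : Fin n → ZMod 2) :
    (BalancedSelection pos y p s ∧ y (Fin.last M) = 0) ↔ y = prefixParity pos p ∧
      ∀ i, prefixParity pos p (pos (i, p i + 1)) = s i ∧
        prefixParity pos p (pos (i, p i + 2)) = s i + 1 := by
  constructor
  · rintro ⟨⟨h1, h2⟩, h3⟩
    have h : y = prefixParity pos p := by
      refine eq_of_cyclic_increments
        (fun k => if (pos.symm k).2 = p (pos.symm k).1 then 0 else 1) ?_ ?_ ?_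
      · intro k; simpa using h1 (pos.symm k)
      · intro k; simpa using prefixParity_eq_pred pos p (pos.symm k)
      · rw [h3, prefixParity_last]
    exact ⟨h, h ▸ h2⟩
  · rintro ⟨rfl, h⟩
    exact ⟨⟨prefixParity_eq_pred pos p, h⟩, prefixParity_last pos p⟩

/-- The parity of the crossing number of the chords opposite to the corners `p` and `q` of the
triangles `i` and `j`; equal to one for `i = j`. -/
def crossing (i j : Fin n) (p q : Fin 3) : ZMod 2 :=
  if i = j then 1 else
    (leInd (pos (j, q + 1)) (pos (i, p + 1)) + leInd (pos (j, q + 2)) (pos (i, p + 1))) +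
      (leInd (pos (j, q + 1)) (pos (i, p + 2)) + leInd (pos (j, q + 2)) (pos (i, p + 2)))

/-- Reversing each of the four comparisons adds 1, and four ones cancel. -/
theorem crossing_symm (i j : Fin n) (p q : Fin 3) :
    crossing pos i j p q = crossing pos j i q p := by
  unfold crossing
  by_cases h : i = j
  · simp [h]
  · have hne : ∀ r r', pos (j, r) ≠ pos (i, r') := fun r r' hp => by
      have := pos.injective hp
      simp only [Prod.mk.injEq] at this
      exact h this.1.symm
    rw [if_neg h, if_neg (Ne.symm h), leInd_swap (hne (q + 1) (p + 1)),
      leInd_swap (hne (q + 2) (p + 1)), leInd_swap (hne (q + 1) (p + 2)),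
      leInd_swap (hne (q + 2) (p + 2))]
    generalize leInd _ _ = A
    generalize leInd _ _ = B
    generalize leInd _ _ = C
    generalize leInd _ _ = D
    revert A B C D
    decide

/-- Each corner of triangle `i` lies on two of its sides, so its contribution cancels. -/
theorem sum_crossing {i j : Fin n} (h : i ≠ j) (q : Fin 3) :
    ∑ p, crossing pos i j p q = 0 := by
  simp only [crossing, if_neg h, Fin.sum_univ_three]
  set f : Fin 3 → ZMod 2 := fun r =>
    leInd (pos (j, q + 1)) (pos (i, r)) + leInd (pos (j, q + 2)) (pos (i, r)) with hf
  change (f 1 + f 2) + (f 2 + f 0) + (f 0 + f 1) = 0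
  generalize f 0 = A
  generalize f 1 = B
  generalize f 2 = C
  revert A B C
  decide

theorem prefixParity_add_prefixParity (p : Fin n → Fin 3) (i : Fin n) :
    prefixParity pos p (pos (i, p i + 1)) + prefixParity pos p (pos (i, p i + 2)) =
      ∑ j, crossing pos i j (p i) (p j) := by
  rw [prefixParity, prefixParity, ← Finset.sum_add_distrib]
  refine Finset.sum_congr rfl fun j _ => ?_
  unfold crossing
  split_ifs with h
  · subst h
    -- A chord's own ends contribute 1, whence the diagonal value of `crossing`.
    have hne : pos (i, p i + 1) ≠ pos (i, p i + 2) := by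
      simp
    rw [leInd_self, leInd_self, leInd_swap hne]
    generalize leInd _ _ = A
    revert A
    decide
  · rfl

theorem sum_balanced_last_eq_one :
    ∑ y, ∑ p, ∑ s, (if BalancedSelection pos y p s ∧ y (Fin.last M) = 0 then (1 : ZMod 2) else 0) = 1 := by
  rw [Finset.sum_comm]
  refine Eq.trans ?_ (sum_prod_sum_eq_one (ι := Fin n) (α := Fin 3) (by decide) (crossing pos)
    (fun i _ _ => if_pos rfl) (crossing_symm pos) (fun i j h => sum_crossing pos h))
  refine Finset.sum_congr rfl fun p _ => ?_
  simp only [balanced_and_last_iff, ← prefixParity_add_prefixParity]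
  rw [Finset.sum_comm]
  simp only [ite_and, Finset.sum_ite_eq', Finset.mem_univ, if_true]
  have h : ∀ s : Fin n → ZMod 2,
      (if ∀ i, prefixParity pos p (pos (i, p i + 1)) = s i ∧
        prefixParity pos p (pos (i, p i + 2)) = s i + 1 then (1 : ZMod 2) else 0) =
      ∏ i, if prefixParity pos p (pos (i, p i + 1)) = s i ∧
        prefixParity pos p (pos (i, p i + 2)) = s i + 1 then (1 : ZMod 2) else 0 := by
    intro s
    rw [Finset.prod_ite_zero]
    simp
  simp only [h]
  have h2 := Finset.prod_univ_sum (fun _ : Fin n => (Finset.univ : Finset (ZMod 2)))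
    (fun i t => if prefixParity pos p (pos (i, p i + 1)) = t ∧
        prefixParity pos p (pos (i, p i + 2)) = t + 1 then (1 : ZMod 2) else 0)
  rw [Fintype.piFinset_univ] at h2
  rw [← h2]
  -- One direction fits if the two parities differ and none otherwise, so the count is their sum.
  refine Finset.prod_congr rfl fun i _ => ?_
  generalize prefixParity pos p (pos (i, p i + 1)) = A
  generalize prefixParity pos p (pos (i, p i + 2)) = B
  revert A B
  decide

end Circle

/-! ### Degrees and the partition into triangles -/

namespace MultiEdgeGraph

variable {V : Type*} [DecidableEq V]

theorem degree_add (G H : MultiEdgeGraph V) (v : V) :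
    (G + H).degree v = G.degree v + H.degree v := by
  simp [degree]

theorem degree_sum {ι : Type*} (s : Finset ι) (G : ι → MultiEdgeGraph V) (v : V) :
    (∑ i ∈ s, G i).degree v = ∑ i ∈ s, (G i).degree v := by
  classical
  induction s using Finset.induction_on with
  | empty => simp [degree]
  | insert i s hi ih => rw [Finset.sum_insert hi, Finset.sum_insert hi, degree_add, ih]

theorem degree_edge (u w v : V) :
    ({s(u, w)} : MultiEdgeGraph V).degree v = (if u = v then 1 else 0) + if w = v then 1 else 0 := by
  simp only [degree, Multiset.map_singleton, Multiset.sum_singleton]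
  have h : (s(u, w) : Sym2 V).toMultiset = u ::ₘ {w} := rfl
  rw [h, Multiset.count_cons, Multiset.count_singleton, add_comm]
  simp only [eq_comm]

theorem degree_cycle {m : ℕ} {x : Fin m → V} (hx : Function.Bijective x) (v : V) :
    (cycle x).degree v = 2 := by
  have h : ∑ i, (if x i = v then 1 else 0) = 1 := by
    obtain ⟨k, rfl⟩ := hx.surjective v
    simp [hx.injective.eq_iff]
  rw [cycle, degree_sum]
  simp only [degree_edge, Finset.sum_add_distrib]
  rw [Equiv.sum_comp (finRotate m) (fun i => if x i = v then 1 else 0), h]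

theorem degree_triangle (t : Fin 3 → V) (v : V) :
    (triangle (t 0) (t 1) (t 2)).degree v = 2 * ∑ r, if t r = v then 1 else 0 := by
  have h : triangle (t 0) (t 1) (t 2) = {s(t 0, t 1)} + {s(t 1, t 2)} + {s(t 2, t 0)} := rfl
  rw [h, degree_add, degree_add, degree_edge, degree_edge, degree_edge, Fin.sum_univ_three]
  ring

/-- In a 4-regular union of a Hamiltonian cycle and triangles, the corners of the triangles
enumerate the vertices. -/
theorem bijective_corners {m n : ℕ} {x : Fin m → V} (hx : Function.Bijective x)
    (t : Fin n → Fin 3 → V)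
    (h : (cycle x + ∑ i, triangle (t i 0) (t i 1) (t i 2)).IsRegular 4) :
    Function.Bijective fun v : Fin n × Fin 3 => t v.1 v.2 := by
  rw [Function.bijective_iff_existsUnique]
  intro v
  have hv := h v
  rw [degree_add, degree_cycle hx, degree_sum] at hv
  simp only [degree_triangle] at hv
  -- The degree equation is `2 + 2 * k = 4`, where `k` is the number of triangle corners at `v`.
  rw [← Finset.mul_sum, ← Fintype.sum_prod_type'
    (f := fun i r => if t i r = v then 1 else 0), ← Finset.card_filter] at hv
  obtain ⟨w, hw⟩ := Finset.card_eq_one.1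
    (Nat.eq_of_mul_eq_mul_left two_pos (Nat.add_left_cancel (hv.trans (by rfl : 4 = 2 + 2 * 1))))
  refine ⟨w, ?_, fun w' hw' => ?_⟩
  · have : w ∈ ({w} : Finset _) := Finset.mem_singleton_self w
    rw [← hw] at this
    simpa using this
  · have : w' ∈ ({w} : Finset _) := by rw [← hw]; simpa using hw'
    simpa using this

end MultiEdgeGraph

theorem Fintype.prod_sum_sum {ι α β R : Type*} [Fintype ι] [DecidableEq ι] [Fintype α] [Fintype β]
    [CommSemiring R] (f : ι → α → β → R) :
    ∏ i, ∑ r, ∑ t, f i r t = ∑ p : ι → α, ∑ s : ι → β, ∏ i, f i (p i) (s i) := by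
  rw [Finset.prod_univ_sum, Fintype.piFinset_univ]
  refine Finset.sum_congr rfl fun p _ => ?_
  rw [Finset.prod_univ_sum, Fintype.piFinset_univ]

/-! ### Expansion of the Laurent polynomial -/

namespace LaurentRing

variable {V : Type*}

theorem prod_single {ι : Type*} (s : Finset ι) (e : ι → V →₀ ℤ) (z : ι → ℤ) :
    ∏ i ∈ s, (AddMonoidAlgebra.single (e i) (z i) : LaurentRing V) =
      AddMonoidAlgebra.single (∑ i ∈ s, e i) (∏ i ∈ s, z i) := by
  classical
  induction s using Finset.induction_on with
  | empty => simp [AddMonoidAlgebra.one_def]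
  | insert i s hi ih =>
    rw [Finset.prod_insert hi, Finset.prod_insert hi, Finset.sum_insert hi, ih,
      AddMonoidAlgebra.single_mul_single]

/-- The sign of a two-valued state. -/
def stateSign (t : ZMod 2) : ℤ := if t = 1 then -1 else 1

theorem stateSign_add_one (t : ZMod 2) : stateSign (t + 1) = -stateSign t := by
  revert t; decide

/-- The exponent vector of `u / v`. -/
noncomputable def ratioExp (u v : V) : V →₀ ℤ := Finsupp.single u 1 - Finsupp.single v 1

theorem one_sub_ratio (u v : V) :
    1 - ratio u v = ∑ t : ZMod 2, AddMonoidAlgebra.single ((t.val : ℤ) • ratioExp u v)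
      (stateSign t) := by
  have h : (Finset.univ : Finset (ZMod 2)) = {0, 1} := rfl
  rw [h, Finset.sum_pair (by decide)]
  simp [stateSign, ratio, ratioExp, AddMonoidAlgebra.one_def, sub_eq_add_neg, ZMod.val_one]

/-- The constants `1` and `-1` cancel, leaving each side in both directions with opposite signs. -/
theorem triangle_factor (t : Fin 3 → V) :
    (1 - ratio (t 0) (t 1)) * (1 - ratio (t 1) (t 2)) * (1 - ratio (t 2) (t 0)) =
      ∑ r : Fin 3, ∑ s : ZMod 2, AddMonoidAlgebra.single
        ((2 * (s.val : ℤ) - 1) • ratioExp (t (r + 1)) (t (r + 2))) (stateSign s) := by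
  have h : (Finset.univ : Finset (ZMod 2)) = {0, 1} := rfl
  have h2 : ∀ r : Fin 3, ∑ s : ZMod 2, (AddMonoidAlgebra.single
        ((2 * (s.val : ℤ) - 1) • ratioExp (t (r + 1)) (t (r + 2))) (stateSign s) : LaurentRing V) =
      ratio (t (r + 2)) (t (r + 1)) - ratio (t (r + 1)) (t (r + 2)) := by
    intro r
    rw [h, Finset.sum_pair (by decide)]
    simp [stateSign, ratio, ratioExp, ZMod.val_one, sub_eq_add_neg, add_comm]
  have hm : ∀ u v w : V, ratio u v * ratio v w = ratio u w := by
    intro u v w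
    simp [ratio, AddMonoidAlgebra.single_mul_single]
  have h1 : ∀ u : V, ratio u u = 1 := by
    intro u
    simp [ratio, AddMonoidAlgebra.one_def]
  simp only [h2, Fin.sum_univ_three]
  change _ = ratio (t 2) (t 1) - ratio (t 1) (t 2) + (ratio (t 0) (t 2) - ratio (t 2) (t 0)) +
    (ratio (t 1) (t 0) - ratio (t 0) (t 1))
  have e1 := hm (t 0) (t 1) (t 2)
  have e2 := hm (t 1) (t 2) (t 0)
  have e3 := hm (t 2) (t 0) (t 1)
  have e4 := hm (t 0) (t 2) (t 0)
  rw [h1] at e4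
  linear_combination (1 - ratio (t 2) (t 0)) * e1 + e2 + e3 - e4

/-- The exponent vector of the monomial chosen by a state. -/
noncomputable def stateExp {m n : ℕ} (x : Fin m → V) (t : Fin n → Fin 3 → V) (y : Fin m → ZMod 2)
    (p : Fin n → Fin 3) (s : Fin n → ZMod 2) : V →₀ ℤ :=
  ∑ k, ((y k).val : ℤ) • ratioExp (x (finRotate m k)) (x k) +
    ∑ i, (2 * ((s i).val : ℤ) - 1) • ratioExp (t i (p i + 1)) (t i (p i + 2))

/-- The coefficient of the monomial chosen by a state. -/
def stateCoeff {m n : ℕ} (y : Fin m → ZMod 2) (s : Fin n → ZMod 2) : ℤ :=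
  (∏ k, stateSign (y k)) * ∏ i, stateSign (s i)

open Classical in
theorem constantTerm_eq_sum {m n : ℕ} (x : Fin m → V) (t : Fin n → Fin 3 → V) :
    constantTerm (cycleTrianglePoly x (fun i => t i 0) (fun i => t i 1) (fun i => t i 2)) =
      ∑ y : Fin m → ZMod 2, ∑ p, ∑ s,
        if stateExp x t y p s = 0 then stateCoeff y s else 0 := by
  simp only [cycleTrianglePoly, triangle_factor]
  simp only [one_sub_ratio]
  rw [Fintype.prod_sum_sum, Finset.prod_univ_sum, Fintype.piFinset_univ, Finset.sum_mul]
  simp only [Finset.mul_sum, prod_single, AddMonoidAlgebra.single_mul_single, constantTerm,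
    AddMonoidAlgebra.coeff_sum, Finsupp.finsetSum_apply, AddMonoidAlgebra.coeff_single,
    Finsupp.single_apply]
  rfl

theorem stateExp_eq_zero_iff {n M : ℕ} {x : Fin (M + 1) → V} (t : Fin n → Fin 3 → V)
    (pos : Fin n × Fin 3 ≃ Fin (M + 1)) (hx : Function.Bijective x)
    (hpos : ∀ i r, x (pos (i, r)) = t i r)
    (y : Fin (M + 1) → ZMod 2) (p : Fin n → Fin 3) (s : Fin n → ZMod 2) :
    stateExp x t y p s = 0 ↔ BalancedSelection pos y p s := by
  classical
  have hcoord : ∀ i r, stateExp x t y p s (t i r) =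
      ((y ((finRotate (M + 1)).symm (pos (i, r)))).val : ℤ) - ((y (pos (i, r))).val : ℤ) +
        (2 * ((s i).val : ℤ) - 1) *
          ((if p i + 1 = r then 1 else 0) - (if p i + 2 = r then 1 else 0)) := by
    intro i r
    have hS : ∀ k, ratioExp (x (finRotate (M + 1) k)) (x k) (t i r) =
        (if k = (finRotate (M + 1)).symm (pos (i, r)) then 1 else 0) -
          (if k = pos (i, r) then 1 else 0) := by
      intro k
      rw [← hpos, ratioExp, Finsupp.sub_apply, Finsupp.single_apply, Finsupp.single_apply]
      simp only [hx.injective.eq_iff, Equiv.eq_symm_apply]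
    have hT : ∀ j, ratioExp (t j (p j + 1)) (t j (p j + 2)) (t i r) =
        if j = i then (if p i + 1 = r then 1 else 0) - (if p i + 2 = r then 1 else 0) else 0 := by
      intro j
      rw [← hpos, ← hpos, ← hpos, ratioExp, Finsupp.sub_apply, Finsupp.single_apply,
        Finsupp.single_apply]
      simp only [hx.injective.eq_iff, EmbeddingLike.apply_eq_iff_eq, Prod.mk.injEq]
      by_cases h : j = i
      · subst h; simp
      · simp [h]
    simp only [stateExp, Finsupp.add_apply, Finsupp.finsetSum_apply, Finsupp.smul_apply, hS, hT,
      smul_eq_mul, mul_sub, mul_ite, mul_one, mul_zero, Finset.sum_sub_distrib,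
      Finset.sum_ite_eq', Finset.mem_univ, if_true]
  have hzero : stateExp x t y p s = 0 ↔ ∀ i r, stateExp x t y p s (t i r) = 0 := by
    refine ⟨fun h i r => by rw [h]; rfl, fun h => Finsupp.ext fun v => ?_⟩
    obtain ⟨k, rfl⟩ := hx.surjective v
    obtain ⟨⟨i, r⟩, rfl⟩ := pos.surjective k
    rw [hpos, h]; rfl
  -- At a chord end the integer equation `±1 = w - u` or its negative fixes both bits, not only
  -- their difference.
  have hlocal : ∀ (u w z : ZMod 2) (q r : Fin 3),
      ((u.val : ℤ) - (w.val : ℤ) + (2 * (z.val : ℤ) - 1) *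
        ((if q + 1 = r then 1 else 0) - (if q + 2 = r then 1 else 0)) = 0) ↔
      (w = u + if r = q then 0 else 1) ∧ (r = q + 1 → w = z) ∧ (r = q + 2 → w = z + 1) := by
    decide
  rw [hzero]
  simp only [hcoord, hlocal, BalancedSelection, Prod.forall]
  constructor
  · intro h
    exact ⟨fun i r => (h i r).1, fun i => ⟨(h i _).2.1 rfl, (h i _).2.2 rfl⟩⟩
  · rintro ⟨h1, h2⟩ i r
    refine ⟨h1 i r, ?_, ?_⟩
    · rintro rfl; exact (h2 i).1
    · rintro rfl; exact (h2 i).2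

theorem stateCoeff_add_one {m n : ℕ} (hmn : Even (m + n)) (y : Fin m → ZMod 2)
    (s : Fin n → ZMod 2) : stateCoeff (y + 1) (s + 1) = stateCoeff y s := by
  simp only [stateCoeff, Pi.add_apply, Pi.one_apply, stateSign_add_one, Finset.prod_neg,
    Finset.card_univ, Fintype.card_fin]
  rw [mul_mul_mul_comm, ← pow_add, hmn.neg_one_pow, one_mul]

theorem intCast_stateCoeff {m n : ℕ} (y : Fin m → ZMod 2) (s : Fin n → ZMod 2) :
    ((stateCoeff y s : ℤ) : ZMod 2) = 1 := by
  have h : ∀ t, ((stateSign t : ℤ) : ZMod 2) = 1 := by decide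
  simp [stateCoeff, h]

theorem sum_balanced_modEq_two {n M : ℕ} (hmn : Even (M + 1 + n))
    (pos : Fin n × Fin 3 ≃ Fin (M + 1)) :
    (∑ y, ∑ p, ∑ s, if BalancedSelection pos y p s then stateCoeff y s else 0) ≡ 2 [ZMOD 4] := by
  set K : ℤ := ∑ y, ∑ p, ∑ s,
    if BalancedSelection pos y p s ∧ y (Fin.last M) = 0 then stateCoeff y s else 0 with hK
  have hK1 : ((K : ℤ) : ZMod 2) = 1 := by
    rw [← sum_balanced_last_eq_one pos, hK]
    push_cast [apply_ite (Int.cast : ℤ → ZMod 2), intCast_stateCoeff]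
    rfl
  have hK2 : ∑ y, ∑ p, ∑ s,
      -- Complementing `y` and `s` exchanges the two values of `y` at the last position.
      (if BalancedSelection pos y p s ∧ y (Fin.last M) ≠ 0 then stateCoeff y s else 0) = K := by
    rw [hK, ← Equiv.sum_comp (Equiv.addRight (1 : Fin (M + 1) → ZMod 2))]
    refine Finset.sum_congr rfl fun y _ => Finset.sum_congr rfl fun p _ => ?_
    rw [← Equiv.sum_comp (Equiv.addRight (1 : Fin n → ZMod 2))]
    refine Finset.sum_congr rfl fun s _ => ?_
    have h : ∀ z : ZMod 2, z + 1 ≠ 0 ↔ z = 0 := by decide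
    simp only [Equiv.coe_addRight, balanced_add_one, stateCoeff_add_one hmn, Pi.add_apply,
      Pi.one_apply, h]
  have hsplit : (∑ y, ∑ p, ∑ s, if BalancedSelection pos y p s then stateCoeff y s else 0)
      = K + K := by
    nth_rewrite 2 [← hK2]
    rw [hK]
    simp only [← Finset.sum_add_distrib]
    refine Finset.sum_congr rfl fun y _ => Finset.sum_congr rfl fun p _ =>
      Finset.sum_congr rfl fun s _ => ?_
    by_cases h1 : BalancedSelection pos y p s <;> by_cases h2 : y (Fin.last M) = 0 <;>
      simp [h1, h2]
  rw [hsplit]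
  have hodd : K % 2 = 1 := by
    rw [← Int.odd_iff]
    exact (ZMod.intCast_eq_one_iff_odd).1 hK1
  unfold Int.ModEq
  omega

end LaurentRing

theorem corollary2 {V : Type*} [DecidableEq V] (n : ℕ) (hn : 1 ≤ n)
    (G : MultiEdgeGraph V) (x : Fin (3 * n) → V) (hx : Function.Bijective x)
    (a b c : Fin n → V) (htri : ∀ i, a i ≠ b i ∧ b i ≠ c i ∧ c i ≠ a i)
    (hG : G = MultiEdgeGraph.cycle x + ∑ i, MultiEdgeGraph.triangle (a i) (b i) (c i))
    (hreg : G.IsRegular 4) :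
    LaurentRing.constantTerm (LaurentRing.cycleTrianglePoly x a b c) ≡ 2 [ZMOD 4] := by
  classical
  subst hG
  have hmn : Even (3 * n + n) := ⟨2 * n, by ring⟩
  -- The normalization of `y` needs a last position, available since `n ≥ 1`.
  obtain ⟨M, hM⟩ : ∃ M, 3 * n = M + 1 := ⟨3 * n - 1, by omega⟩
  revert x
  rw [hM] at hmn ⊢
  intro x hx hreg
  have hT := MultiEdgeGraph.bijective_corners hx (fun i => ![a i, b i, c i]) hreg
  let pos := (Equiv.ofBijective _ hT).trans (Equiv.ofBijective x hx).symm
  have hpos : ∀ i r, x (pos (i, r)) = ![a i, b i, c i] r := fun i r =>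
    (Equiv.ofBijective x hx).apply_symm_apply _
  have h := LaurentRing.constantTerm_eq_sum x (fun i => ![a i, b i, c i])
  simp only [LaurentRing.stateExp_eq_zero_iff _ pos hx hpos] at h
  have h2 := LaurentRing.sum_balanced_modEq_two hmn pos
  have h3 : LaurentRing.constantTerm (LaurentRing.cycleTrianglePoly x a b c) =
    ∑ y, ∑ p, ∑ s, if BalancedSelection pos y p s then LaurentRing.stateCoeff y s else 0 := by
    refine (Eq.trans rfl h).trans ?_
    congr!
  rwa [h3]
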